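/- Let $\ell>2$ be a prime number, let $\overline{\mathbb{Q}}_\ell$ be an algebraic closure of $\mathbb{Q}_\ell$, let $v$ be the valuation on $\overline{\mathbb{Q}}_\ell$ extending the $\ell$-adic one, normalized by $v(\ell)=1$ (and $v(0)=\infty$), and let $\overline{\mathfrak m}=\{x\in\overline{\mathbb{Q}}_\ell : v(x)>0\}$. Let $\mathbf F=(F_1,F_2)$ be a $2$-dimensional formal group law over $\mathbb{Z}_\ell$, that is, a pair of power series $F_i(\mathbf X,\mathbf Y)\in\mathbb{Z}_\ell[[X_1,X_2,Y_1,Y_2]]$ with $F_i\equiv X_i+Y_i$ modulo terms of degree $\geq 2$ and $\mathbf F(\mathbf F(\mathbf X,\mathbf Y),\mathbf Z)=\mathbf F(\mathbf X,\mathbf F(\mathbf Y,\mathbf Z))$. Suppose that $\mathbf F$ is symmetric, that is, $F_2(X_2,X_1,Y_2,Y_1)=F_1(X_1,X_2,Y_1,Y_2)$. Let $\overline{\mathbf F}$ be the reduction of $\mathbf F$ modulo $\ell$, and let $\overline{[\ell]}=(\overline{[\ell]}_1,\overline{[\ell]}_2)$, with $\overline{[\ell]}_i\in\mathbb{F}_\ell[[Z_1,Z_2]]$,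 be its multiplication by $\ell$ map, where $[1](\mathbf Z)=\mathbf Z$ and $[m+1](\mathbf Z)=\overline{\mathbf F}(\mathbf Z,[m](\mathbf Z))$ for $m\ge 1$. Assume that * $\mathbf F$ has height $4$: $\mathbb{F}_\ell[[Z_1,Z_2]]$ is finitely generated as a module over its subring $\mathbb{F}_\ell[[\overline{[\ell]}_1,\overline{[\ell]}_2]]$, and free of rank $\ell^4$ over it; * $\mathbf F$ has Frobenius exponent $r=2$: the smallest $u\geq 1$ such that some variable $Z_j$ occurs raised to the $u$-th power in some monomial with non-zero coefficient of some $\overline{[\ell]}_i$ is $u=\ell^2$. Let $V$ be the set of $\ell$-torsion points of $\overline{\mathfrak m}\times\overline{\mathfrak m}$ endowed with the addition $(\mathbf x,\mathbf y)\mapsto(F_1(\mathbf x,\mathbf y),F_2(\mathbf x,\mathbf y))$. Then every non-zero $(x_0,y_0)\in V$ satisfies $$\min\{v(x_0),v(y_0)\}=\frac{1}{\ell^2-1}.$$ -/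

import Mathlib

noncomputable section

/-- An `n`-dimensional formal group law over `R`: an `n`-tuple of power series in the variables
`X₁, …, Xₙ` (indexed by `Sum.inl`) and `Y₁, …, Yₙ` (indexed by `Sum.inr`). -/
structure FormalGroupLaw (R : Type*) [CommRing R] (n : ℕ) where
  /-- The power series `F₁(X, Y), …, Fₙ(X, Y)`. -/
  series : Fin n → MvPowerSeries (Fin n ⊕ Fin n) R
  /-- `Fᵢ(X, Y) ≡ Xᵢ + Yᵢ` modulo terms of degree two. -/
  linear_part : ∀ (i : Fin n) (d : (Fin n ⊕ Fin n) →₀ ℕ), d.degree < 2 →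
    MvPowerSeries.coeff d (series i) =
      MvPowerSeries.coeff d
        (MvPowerSeries.X (Sum.inl i) + MvPowerSeries.X (Sum.inr i) :
          MvPowerSeries (Fin n ⊕ Fin n) R)
  /-- `F(F(X, Y), Z) = F(X, F(Y, Z))`, in the variables `X` (`Sum.inl`), `Y` (`Sum.inr ∘ Sum.inl`)
  and `Z` (`Sum.inr ∘ Sum.inr`). -/
  assoc : ∀ i : Fin n,
    MvPowerSeries.subst (S := R) (τ := Fin n ⊕ (Fin n ⊕ Fin n))
      (Sum.elim
        (fun j => MvPowerSeries.subst
          (Sum.elim (fun a => MvPowerSeries.X (Sum.inl a))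
            (fun a => MvPowerSeries.X (Sum.inr (Sum.inl a)))) (series j))
        (fun j => MvPowerSeries.X (Sum.inr (Sum.inr j)))) (series i) =
    MvPowerSeries.subst (S := R) (τ := Fin n ⊕ (Fin n ⊕ Fin n))
      (Sum.elim
        (fun j => MvPowerSeries.X (Sum.inl j))
        (fun j => MvPowerSeries.subst
          (Sum.elim (fun a => MvPowerSeries.X (Sum.inr (Sum.inl a)))
            (fun a => MvPowerSeries.X (Sum.inr (Sum.inr a)))) (series j))) (series i)

namespace FormalGroupLaw

open MvPowerSeries

theorem constantCoeff_series {R : Type*} [CommRing R] {n : ℕ} (F : FormalGroupLaw R n)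
    (i : Fin n) : constantCoeff (F.series i) = 0 := by
  have h := F.linear_part i 0 (by simp)
  simpa using h

theorem hasSubst_elim {R : Type*} [CommRing R] {n : ℕ} {τ : Type*}
    {a b : Fin n → MvPowerSeries τ R} (ha : ∀ i, constantCoeff (a i) = 0)
    (hb : ∀ i, constantCoeff (b i) = 0) : HasSubst (Sum.elim a b) := by
  apply hasSubst_of_constantCoeff_zero
  rintro (i | i)
  · exact ha i
  · exact hb i

theorem constantCoeff_subst_series {R : Type*} [CommRing R] {n : ℕ} {τ : Type*}
    (F : FormalGroupLaw R n) {a b : Fin n → MvPowerSeries τ R}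
    (ha : ∀ i, constantCoeff (a i) = 0) (hb : ∀ i, constantCoeff (b i) = 0) (i : Fin n) :
    constantCoeff (subst (Sum.elim a b) (F.series i)) = 0 := by
  apply constantCoeff_subst_eq_zero (hasSubst_elim ha hb) _ (F.constantCoeff_series i)
  rintro (i | i)
  · exact ha i
  · exact hb i

/-- The formal group law over `S` obtained by applying a ring homomorphism `φ : R → S` to all the
coefficients. -/
def map {R S : Type*} [CommRing R] [CommRing S] {n : ℕ} (φ : R →+* S)
    (F : FormalGroupLaw R n) : FormalGroupLaw S n where
  series i := MvPowerSeries.map φ (F.series i)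
  linear_part i d hd := by
    rw [coeff_map, F.linear_part i d hd, ← coeff_map]
    simp
  assoc i := by
    have h := congrArg (MvPowerSeries.map φ) (F.assoc i)
    rw [map_subst (hasSubst_elim (fun j => F.constantCoeff_subst_series (by simp) (by simp) j)
        (by simp)),
      map_subst (hasSubst_elim (by simp)
        (fun j => F.constantCoeff_subst_series (by simp) (by simp) j))] at h
    convert h using 2
    · funext s
      rcases s with j | j
      · simp only [Sum.elim_inl]
        rw [map_subst (hasSubst_elim (by simp) (by simp))]
        congr 1
        funext t
        rcases t with a | a <;> simp
      · simp
    · funext s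
      rcases s with j | j
      · simp
      · simp only [Sum.elim_inr]
        rw [map_subst (hasSubst_elim (by simp) (by simp))]
        congr 1
        funext t
        rcases t with a | a <;> simp

/-- The multiplication by `m` map `[m](Z) = ([m]₁(Z), …, [m]ₙ(Z))`:
`[0](Z) = 0`, `[1](Z) = Z`, `[m + 1](Z) = F([1](Z), [m](Z))` for `m ≥ 1`. -/
def mulSeries {R : Type*} [CommRing R] {n : ℕ} (F : FormalGroupLaw R n) :
    ℕ → Fin n → MvPowerSeries (Fin n) R
  | 0 => fun _ => 0
  | 1 => fun i => X i
  | m + 2 => fun i => subst (Sum.elim X (F.mulSeries (m + 1))) (F.series i)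

theorem constantCoeff_mulSeries {R : Type*} [CommRing R] {n : ℕ} (F : FormalGroupLaw R n) :
    ∀ (m : ℕ) (i : Fin n), constantCoeff (F.mulSeries m i) = 0
  | 0, i => by simp [mulSeries]
  | 1, i => by simp [mulSeries]
  | m + 2, i => by
    rw [mulSeries]
    exact F.constantCoeff_subst_series (by simp) (F.constantCoeff_mulSeries (m + 1)) i

theorem hasSubst_mulSeries {R : Type*} [CommRing R] {n : ℕ} (F : FormalGroupLaw R n) (m : ℕ) :
    HasSubst (F.mulSeries m) :=
  hasSubst_of_constantCoeff_zero (F.constantCoeff_mulSeries m)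

/-- The subring `R[[[m]₁(Z), …, [m]ₙ(Z)]]` of `R[[Z₁, …, Zₙ]]`: the power series obtained by
substituting `[m]₁(Z), …, [m]ₙ(Z)` for the variables in some power series. -/
def mulSubalgebra {R : Type*} [CommRing R] {n : ℕ} (F : FormalGroupLaw R n) (m : ℕ) :
    Subalgebra R (MvPowerSeries (Fin n) R) :=
  (substAlgHom (F.hasSubst_mulSeries m)).range

/-- A formal group law over a field `k` of characteristic `ℓ` has (finite) height `h` if
`k[[Z₁, …, Zₙ]]` is finitely generated as a module over `k[[[ℓ]₁(Z), …, [ℓ]ₙ(Z)]]`, and is a free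
module over it, of rank `ℓ ^ h`. -/
def HasHeight {k : Type*} [Field k] {n : ℕ} (F : FormalGroupLaw k n) (ℓ h : ℕ) : Prop :=
  Module.Finite (F.mulSubalgebra ℓ) (MvPowerSeries (Fin n) k) ∧
  Module.Free (F.mulSubalgebra ℓ) (MvPowerSeries (Fin n) k) ∧
  Module.finrank (F.mulSubalgebra ℓ) (MvPowerSeries (Fin n) k) = ℓ ^ h

/-- A formal group law over a field `k` of characteristic `ℓ` has Frobenius exponent `r` if
`u = ℓ ^ r` is the smallest positive exponent such that, in some `[ℓ]ᵢ(Z)`, some variable `Zⱼ`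
occurs in a monomial with non-zero coefficient raised to the `u`-th power. -/
def HasFrobeniusExponent {k : Type*} [Field k] {n : ℕ} (F : FormalGroupLaw k n) (ℓ r : ℕ) : Prop :=
  IsLeast {u : ℕ | 0 < u ∧ ∃ (i j : Fin n) (d : Fin n →₀ ℕ),
    coeff d (F.mulSeries ℓ i) ≠ 0 ∧ d j = u} (ℓ ^ r)

/-- A formal group law of dimension `2` is symmetric if `F₂(X₂, X₁, Y₂, Y₁) = F₁(X₁, X₂, Y₁, Y₂)`
(the indices `1`, `2` are `0`, `1` here). -/
def IsSymmetric {R : Type*} [CommRing R] (F : FormalGroupLaw R 2) : Prop :=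
  subst (S := R)
    (Sum.elim ![X (Sum.inl 1), X (Sum.inl 0)] ![X (Sum.inr 1), X (Sum.inr 0)] :
      Fin 2 ⊕ Fin 2 → MvPowerSeries (Fin 2 ⊕ Fin 2) R) (F.series 1) = F.series 0

/-- The reduction of a formal group law over `ℤ_ℓ` modulo the maximal ideal. -/
def reduction {ℓ : ℕ} [Fact ℓ.Prime] {n : ℕ} (F : FormalGroupLaw ℤ_[ℓ] n) :
    FormalGroupLaw (ZMod ℓ) n :=
  F.map PadicInt.toZMod

end FormalGroupLaw

/-- The valuation on the algebraic closure of `ℚ_ℓ` normalized by `v(ℓ) = 1`, with `v(0) = ∞`;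
the norm on `PadicAlgCl ℓ` is the one extending the `ℓ`-adic norm, for which `‖ℓ‖ = 1 / ℓ`. -/
def algClVal {ℓ : ℕ} [Fact ℓ.Prime] (x : PadicAlgCl ℓ) : WithTop ℝ :=
  open Classical in if x = 0 then ⊤ else ((-Real.logb ℓ ‖x‖ : ℝ) : WithTop ℝ)

/-- The value at `x` of a power series with coefficients in `ℤ_ℓ`, as the sum of a convergent series
in the algebraic closure of `ℚ_ℓ` (it converges whenever all the `x s` have positive valuation,
the number of variables being finite). -/
def algClEval {ℓ : ℕ} [Fact ℓ.Prime] {σ : Type*} [Finite σ] (f : MvPowerSeries σ ℤ_[ℓ])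
    (x : σ → PadicAlgCl ℓ) : PadicAlgCl ℓ :=
  ∑' d : σ →₀ ℕ, algebraMap ℚ_[ℓ] (PadicAlgCl ℓ) ((MvPowerSeries.coeff d f : ℤ_[ℓ]) : ℚ_[ℓ]) *
    d.prod fun s e => x s ^ e

namespace FormalGroupLaw

/-- The addition law `(x, y) ↦ (F₁(x, y), …, Fₙ(x, y))` on tuples of elements of positive
valuation. -/
def addPoint {ℓ : ℕ} [Fact ℓ.Prime] {n : ℕ} (F : FormalGroupLaw ℤ_[ℓ] n)
    (x y : Fin n → PadicAlgCl ℓ) : Fin n → PadicAlgCl ℓ :=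
  fun i => algClEval (F.series i) (Sum.elim x y)

/-- The multiple `m · x = x ⊕ (x ⊕ ⋯ )` for the addition law of `F`. -/
def nsmulPoint {ℓ : ℕ} [Fact ℓ.Prime] {n : ℕ} (F : FormalGroupLaw ℤ_[ℓ] n) :
    ℕ → (Fin n → PadicAlgCl ℓ) → Fin n → PadicAlgCl ℓ
  | 0, _ => 0
  | 1, x => x
  | m + 2, x => F.addPoint x (F.nsmulPoint (m + 1) x)

/-- The set `V` of `ℓ`-torsion points of the group of tuples of elements of positive valuation
in the algebraic closure of `ℚ_ℓ`, with the addition law of `F`. -/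
def torsionPoints {ℓ : ℕ} [Fact ℓ.Prime] {n : ℕ} (F : FormalGroupLaw ℤ_[ℓ] n) :
    Set (Fin n → PadicAlgCl ℓ) :=
  {x | (∀ i, 0 < algClVal (x i)) ∧ F.nsmulPoint ℓ x = 0}

end FormalGroupLaw

end

/-! Put q = ℓ². Minimality of the Frobenius exponent makes every variable occurring in a monomial of
[ℓ] mod ℓ have exponent at least q. Hence both components have order at least q, and their parts of
degree q are combinations of Z₁^q and Z₂^q, given by a 2 × 2 matrix A. Height 4 bounds the dimension
of k[[Z₁, Z₂]] / ([ℓ]₁, [ℓ]₂) by q². If A were singular mod ℓ, some combination of the two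
components would have order at least q + 1 and could replace one generator of the ideal; the
intersection multiplicity would then be at least q(q + 1) > q² (`mul_le_card_of_le_order`,
`det_powCoeffMatrix_ne_zero`). So A, lifted to ℤ_ℓ, is invertible. At a torsion point x whose
largest coordinate has norm ρ > 0, this gives 0 = ℓx + A x^q + error, where x^q is taken
coordinatewise and the error has norm at most max(ρ²/ℓ, ρ^(q+1)) (`norm_nsmulPoint_sub_le`). As A
preserves the maximum norm, the two main terms have norms ρ/ℓ and ρ^q, and they can cancel only if
these agree (`inv_mul_eq_pow_of_nsmulPoint_eq_zero`). Taking logarithms, v = 1/(q - 1). -/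

noncomputable section

/-! ### Intersection multiplicity of two plane curves at the origin. -/

namespace MvPowerSeries

open _root_.Finset

/-- The exponents in two variables of total degree less than `N`. -/
def exponentsBelow (N : ℕ) : Finset (Fin 2 →₀ ℕ) :=
  (range N).biUnion fun n => finsuppAntidiag univ n

theorem mem_exponentsBelow {N : ℕ} {d : Fin 2 →₀ ℕ} : d ∈ exponentsBelow N ↔ d.degree < N := by
  simp [exponentsBelow, Finsupp.degree_eq_sum]

theorem two_mul_card_exponentsBelow (N : ℕ) : 2 * #(exponentsBelow N) = N * (N + 1) := by
  have hcard (n : ℕ) : #(finsuppAntidiag (univ : Finset (Fin 2)) n) = n + 1 := by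
    rw [← Nat.card_antidiagonal n]
    refine card_nbij' (fun d => (d 0, d 1)) (fun p => Finsupp.equivFunOnFinite.symm ![p.1, p.2])
      ?_ ?_ ?_ ?_
    · intro d hd
      simpa using hd
    · intro p hp
      simpa using hp
    · intro d _
      ext i
      fin_cases i <;> simp
    · intro p _
      simp
  rw [exponentsBelow, card_biUnion]
  · simp only [hcard]
    induction N with
    | zero => simp
    | succ N ih => rw [sum_range_succ, mul_add, ih]; ring
  · intro i _ j _ hij
    refine disjoint_left.2 fun d hi hj => ?_
    simp only [mem_finsuppAntidiag] at hi hj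
    exact hij (hi.1.symm.trans hj.1)

/-- The power series with prescribed coefficients in degrees less than `N`, and no others. -/
def ofCoeffsBelow (k : Type*) [Semiring k] (N : ℕ) :
    (exponentsBelow N → k) →ₗ[k] MvPowerSeries (Fin 2) k :=
  LinearMap.pi fun d => if h : d ∈ exponentsBelow N then LinearMap.proj ⟨d, h⟩ else 0

theorem coeff_ofCoeffsBelow {k : Type*} [Semiring k] {N : ℕ} (c : exponentsBelow N → k)
    {d : Fin 2 →₀ ℕ} (h : d ∈ exponentsBelow N) :
    coeff d (ofCoeffsBelow k N c) = c ⟨d, h⟩ := by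
  change (if h : d ∈ exponentsBelow N then LinearMap.proj ⟨d, h⟩ else 0 :
    (exponentsBelow N → k) →ₗ[k] k) c = _
  rw [dif_pos h, LinearMap.proj_apply]

/-- The coefficients in degrees less than `N`. -/
def coeffsBelow (k : Type*) [Semiring k] (N : ℕ) :
    MvPowerSeries (Fin 2) k →ₗ[k] (exponentsBelow N → k) :=
  LinearMap.pi fun d => coeff d.1

theorem coeffsBelow_apply {k : Type*} [Semiring k] {N : ℕ} (f : MvPowerSeries (Fin 2) k)
    (d : exponentsBelow N) : coeffsBelow k N f d = coeff d.1 f :=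
  rfl

theorem coeffsBelow_ofCoeffsBelow {k : Type*} [Semiring k] {N : ℕ} (c : exponentsBelow N → k) :
    coeffsBelow k N (ofCoeffsBelow k N c) = c := by
  ext d
  exact coeff_ofCoeffsBelow c d.2

/-- Changing u in degrees at least n changes uf only in degrees at least m + n. Modulo degree m + n,
the multiples of f thus come from a finite-dimensional space of multipliers. -/
theorem coeffsBelow_mul_of_le_order {k : Type*} [CommRing k] {f : MvPowerSeries (Fin 2) k} {m n : ℕ}
    (hf : (m : ℕ∞) ≤ f.order) (u : MvPowerSeries (Fin 2) k) :
    coeffsBelow k (m + n) (ofCoeffsBelow k n (coeffsBelow k n u) * f) =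
      coeffsBelow k (m + n) (u * f) := by
  rw [← sub_eq_zero, ← map_sub, ← sub_mul]
  ext d
  rw [coeffsBelow_apply, Pi.zero_apply]
  refine coeff_of_lt_order ?_
  have hu : (n : ℕ∞) ≤ (ofCoeffsBelow k n (coeffsBelow k n u) - u).order := by
    refine nat_le_order fun e he => ?_
    rw [map_sub, coeff_ofCoeffsBelow _ (mem_exponentsBelow.2 he), sub_eq_zero]
    rfl
  calc ((d.1.degree : ℕ) : ℕ∞) < ((m + n : ℕ) : ℕ∞) := by
        exact_mod_cast mem_exponentsBelow.1 d.2
    _ ≤ _ := by rw [add_comm, Nat.cast_add]; exact (add_le_add hu hf).trans le_order_mul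

/-- The intersection multiplicity of two plane curves at the origin is at least the product of
their multiplicities: if `k[[Z₁, Z₂]]` is spanned by a finite family modulo `(f, g)`, then the
family has at least `mn` members, where `m` and `n` bound the orders of `f` and `g` from below. -/
theorem mul_le_card_of_le_order {k : Type*} [Field k] {f g : MvPowerSeries (Fin 2) k} {m n : ℕ}
    (hf : (m : ℕ∞) ≤ f.order) (hg : (n : ℕ∞) ≤ g.order) {ι : Type*} [Fintype ι]
    (b : ι → MvPowerSeries (Fin 2) k)
    (hb : ∀ h, ∃ (c : ι → k) (u v : MvPowerSeries (Fin 2) k),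
      h = ∑ i, c i • b i + (u * f + v * g)) :
    m * n ≤ Fintype.card ι := by
  -- Everything is truncated in degree m + n: f then needs multipliers only below degree n, and g
  -- only below degree m. Surjectivity bounds the size of the family below by (m+n)(m+n+1)/2 -
  -- n(n+1)/2 - m(m+1)/2 = mn.
  let T : ((ι → k) × (exponentsBelow n → k) × (exponentsBelow m → k)) →ₗ[k]
      (exponentsBelow (m + n) → k) :=
    (coeffsBelow k (m + n)).comp
      ((Fintype.linearCombination k b).coprod
        (((LinearMap.mulRight k f).comp (ofCoeffsBelow k n)).coprod
          ((LinearMap.mulRight k g).comp (ofCoeffsBelow k m))))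
  have hT : Function.Surjective T := by
    intro w
    obtain ⟨c, u, v, h⟩ := hb (ofCoeffsBelow k (m + n) w)
    refine ⟨(c, coeffsBelow k n u, coeffsBelow k m v), ?_⟩
    have h1 := coeffsBelow_mul_of_le_order (n := n) hf u
    have h2 := coeffsBelow_mul_of_le_order (n := m) hg v
    rw [add_comm n m] at h2
    rw [← coeffsBelow_ofCoeffsBelow w, h]
    simp only [T, LinearMap.comp_apply, LinearMap.coprod_apply, LinearMap.mulRight_apply, map_add,
      h1, h2, Fintype.linearCombination_apply]
  have hdim := LinearMap.finrank_le_finrank_of_surjective hT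
  simp only [Module.finrank_prod, Module.finrank_fintype_fun_eq_card, Fintype.card_coe] at hdim
  have h1 := two_mul_card_exponentsBelow (m + n)
  have h2 := two_mul_card_exponentsBelow m
  have h3 := two_mul_card_exponentsBelow n
  nlinarith

theorem exists_eq_mul_X_add_mul_X {k : Type*} [CommRing k] {φ : MvPowerSeries (Fin 2) k}
    (hφ : constantCoeff φ = 0) : ∃ u v : MvPowerSeries (Fin 2) k, φ = u * X 0 + v * X 1 := by
  classical
  -- ψ collects the monomials free of `X 0`; without a constant term they are all divisible by `X
  -- 1`.
  let ψ : MvPowerSeries (Fin 2) k := fun d => if d 0 = 0 then coeff d φ else 0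
  have hψ (d) : coeff d ψ = if d 0 = 0 then coeff d φ else 0 := rfl
  obtain ⟨v, hv⟩ : X 1 ∣ ψ := by
    rw [X_dvd_iff]
    intro d hd
    rw [hψ]
    split_ifs with h
    · have : d = 0 := by ext i; fin_cases i <;> simpa
      simpa [this] using hφ
    · rfl
  obtain ⟨u, hu⟩ : X 0 ∣ φ - ψ := by
    rw [X_dvd_iff]
    intro d hd
    simp [hψ, hd]
  refine ⟨u, v, ?_⟩
  rw [mul_comm u, mul_comm v, ← hu, ← hv, sub_add_cancel]

end MvPowerSeries

/-! ### Invertibility of the part of degree ℓ^r of [ℓ]. -/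

namespace FormalGroupLaw

open MvPowerSeries

/-- A formal group of height `h` makes `k[[Z₁, Z₂]] / ([ℓ]₁, [ℓ]₂)` a vector space of dimension at
most `ℓ ^ h`. -/
theorem HasHeight.exists_span {k : Type*} [Field k] {F : FormalGroupLaw k 2} {ℓ h : ℕ}
    (hF : F.HasHeight ℓ h) : ∃ b : Fin (ℓ ^ h) → MvPowerSeries (Fin 2) k,
      ∀ g, ∃ (c : Fin (ℓ ^ h) → k) (u v : MvPowerSeries (Fin 2) k),
        g = ∑ i, c i • b i + (u * F.mulSeries ℓ 0 + v * F.mulSeries ℓ 1) := by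
  obtain ⟨hfin, hfree, hrank⟩ := hF
  let b := Module.finBasisOfFinrankEq (F.mulSubalgebra ℓ) (MvPowerSeries (Fin 2) k) hrank
  refine ⟨b, fun g => ?_⟩
  have hs := F.hasSubst_mulSeries ℓ
  -- Each scalar of the subring is a constant modulo the ideal ([ℓ]₁, [ℓ]₂), so a basis over the
  -- subring spans the quotient over k.
  have key (r : F.mulSubalgebra ℓ) : ∃ (c : k) (u v : MvPowerSeries (Fin 2) k),
      (r : MvPowerSeries (Fin 2) k) = C c + (u * F.mulSeries ℓ 0 + v * F.mulSeries ℓ 1) := by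
    obtain ⟨φ, hφ⟩ := r.2
    obtain ⟨u, v, huv⟩ := exists_eq_mul_X_add_mul_X (φ := φ - C (constantCoeff φ)) (by simp)
    refine ⟨constantCoeff φ, subst (F.mulSeries ℓ) u, subst (F.mulSeries ℓ) v, ?_⟩
    rw [← hφ, ← sub_eq_iff_eq_add', ← subst_C (a := F.mulSeries ℓ)]
    simp only [AlgHom.toRingHom_eq_coe, RingHom.coe_coe, substAlgHom_apply]
    rw [← subst_sub hs, huv, subst_add hs, subst_mul hs, subst_mul hs, subst_X hs, subst_X hs]
  choose c u v hcuv using key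
  refine ⟨fun i => c (b.repr g i), ∑ i, u (b.repr g i) * b i, ∑ i, v (b.repr g i) * b i, ?_⟩
  conv_lhs => rw [← b.sum_repr g]
  simp only [Finset.sum_mul, ← Finset.sum_add_distrib]
  refine Finset.sum_congr rfl fun i _ => ?_
  rw [Subalgebra.smul_def, hcuv, smul_eq_mul, smul_eq_C_mul]
  ring

/-- The monomials of degree less than `ℓ ^ r` do not occur in `[ℓ]`. -/
theorem HasFrobeniusExponent.le_degree {k : Type*} [Field k] {n : ℕ} {F : FormalGroupLaw k n}
    {ℓ r : ℕ} (hF : F.HasFrobeniusExponent ℓ r) {i : Fin n} {d : Fin n →₀ ℕ}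
    (hd : coeff d (F.mulSeries ℓ i) ≠ 0) : ℓ ^ r ≤ d.degree := by
  have hd0 : d ≠ 0 := by
    rintro rfl
    exact hd (by simpa using F.constantCoeff_mulSeries ℓ i)
  obtain ⟨j, hj⟩ := Finsupp.ne_iff.1 hd0
  exact (hF.2 ⟨Nat.pos_of_ne_zero hj, i, j, d, hd, rfl⟩).trans (Finsupp.le_degree j d)

theorem HasFrobeniusExponent.le_order {k : Type*} [Field k] {n : ℕ} {F : FormalGroupLaw k n}
    {ℓ r : ℕ} (hF : F.HasFrobeniusExponent ℓ r) (i : Fin n) :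
    ((ℓ ^ r : ℕ) : ℕ∞) ≤ (F.mulSeries ℓ i).order :=
  nat_le_order fun _ hd => by_contra fun h => (hF.le_degree h).not_gt hd

/-- The monomials of degree `ℓ ^ r` which occur in `[ℓ]` are powers of a variable. -/
theorem HasFrobeniusExponent.eq_single {k : Type*} [Field k] {n : ℕ} {F : FormalGroupLaw k n}
    {ℓ r : ℕ} (hF : F.HasFrobeniusExponent ℓ r) {i : Fin n} {d : Fin n →₀ ℕ}
    (hd : coeff d (F.mulSeries ℓ i) ≠ 0) (hdeg : d.degree = ℓ ^ r) :
    ∃ j, d = Finsupp.single j (ℓ ^ r) := by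
  have hd0 : d ≠ 0 := by
    rintro rfl
    exact hd (by simpa using F.constantCoeff_mulSeries ℓ i)
  obtain ⟨j, hj⟩ := Finsupp.ne_iff.1 hd0
  have hle := hF.2 ⟨Nat.pos_of_ne_zero hj, i, j, d, hd, rfl⟩
  have hsum := Finset.add_sum_erase Finset.univ d (Finset.mem_univ j)
  rw [← Finsupp.degree_eq_sum, hdeg] at hsum
  -- The exponent of Z_j alone is at least ℓ^r, which exhausts the degree.
  have hz : ∑ x ∈ Finset.univ.erase j, d x = 0 := by omega
  refine ⟨j, Finsupp.ext fun s => ?_⟩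
  by_cases hs : s = j
  · subst hs; simp; omega
  · rw [Finsupp.single_eq_of_ne hs]
    exact Finset.sum_eq_zero_iff.1 hz s (by simp [hs])

/-- The coefficients of `Z_j ^ q` in `[ℓ]_i`. -/
def powCoeffMatrix {R : Type*} [CommRing R] {n : ℕ} (F : FormalGroupLaw R n) (ℓ q : ℕ) :
    Matrix (Fin n) (Fin n) R :=
  Matrix.of fun i j => coeff (Finsupp.single j q) (F.mulSeries ℓ i)

theorem powCoeffMatrix_apply {R : Type*} [CommRing R] {n : ℕ} (F : FormalGroupLaw R n) (ℓ q : ℕ)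
    (i j : Fin n) :
    F.powCoeffMatrix ℓ q i j = coeff (Finsupp.single j q) (F.mulSeries ℓ i) :=
  rfl

/-- A combination of `[ℓ]₁` and `[ℓ]₂` without terms of degree `ℓ ^ r` vanishes to higher order. -/
theorem HasFrobeniusExponent.lt_order_of_vecMul_eq_zero {k : Type*} [Field k] {n : ℕ}
    {F : FormalGroupLaw k n} {ℓ r : ℕ} (hF : F.HasFrobeniusExponent ℓ r) {a : Fin n → k}
    (ha : Matrix.vecMul a (F.powCoeffMatrix ℓ (ℓ ^ r)) = 0) :
    ((ℓ ^ r + 1 : ℕ) : ℕ∞) ≤ (∑ i, C (a i) * F.mulSeries ℓ i).order := by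
  refine nat_le_order fun d hd => ?_
  simp only [map_sum, coeff_C_mul]
  by_cases hex : ∃ j, d = Finsupp.single j (ℓ ^ r)
  · obtain ⟨j, rfl⟩ := hex
    exact congrFun ha j
  · refine Finset.sum_eq_zero fun i _ => ?_
    by_contra h
    have h' := right_ne_zero_of_mul h
    exact hex (hF.eq_single h' (le_antisymm (by omega) (hF.le_degree h')))

/-- With q = ℓ^r, a linear relation between the rows yields a member of the ideal of order at least
q + 1. Paired with a component of order at least q, it forces dimension at least q(q + 1), above the
q² allowed by the height. -/
theorem det_powCoeffMatrix_ne_zero {k : Type*} [Field k] {F : FormalGroupLaw k 2} {ℓ r : ℕ}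
    (hℓ : 0 < ℓ) (hh : F.HasHeight ℓ (2 * r)) (hr : F.HasFrobeniusExponent ℓ r) :
    (F.powCoeffMatrix ℓ (ℓ ^ r)).det ≠ 0 := by
  intro hdet
  obtain ⟨a, ha, haM⟩ := Matrix.exists_vecMul_eq_zero_iff.2 hdet
  have hord := hr.lt_order_of_vecMul_eq_zero haM
  rw [Fin.sum_univ_two] at hord
  obtain ⟨b, hb⟩ := hh.exists_span
  have hpos : 0 < ℓ ^ r := pow_pos hℓ r
  have hfin (f : MvPowerSeries (Fin 2) k) (hf : ((ℓ ^ r : ℕ) : ℕ∞) ≤ f.order)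
      (hbf : ∀ h, ∃ (c : Fin (ℓ ^ (2 * r)) → k) (u v : MvPowerSeries (Fin 2) k),
        h = ∑ i, c i • b i + (u * f +
          v * (C (a 0) * F.mulSeries ℓ 0 + C (a 1) * F.mulSeries ℓ 1))) : False := by
    have := mul_le_card_of_le_order hf hord b hbf
    rw [Fintype.card_fin, pow_mul', sq] at this
    exact absurd (Nat.le_of_mul_le_mul_left this hpos) (by omega)
  have hC {x : k} (hx : x ≠ 0) : C x⁻¹ * C x = (1 : MvPowerSeries (Fin 2) k) := by
    rw [← map_mul, inv_mul_cancel₀ hx, map_one]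
  -- The combination replaces a component whose coefficient is non-zero, so the ideal is unchanged.
  by_cases h0 : a 0 = 0
  · have h1 : a 1 ≠ 0 := fun h1 => ha (by ext i; fin_cases i <;> simp [h0, h1])
    refine hfin _ (hr.le_order 0) fun h => ?_
    obtain ⟨c, u, v, rfl⟩ := hb h
    refine ⟨c, u, v * C (a 1)⁻¹, ?_⟩
    rw [h0, map_zero]
    linear_combination (-v * F.mulSeries ℓ 1) * hC h1
  · refine hfin _ (hr.le_order 1) fun h => ?_
    obtain ⟨c, u, v, rfl⟩ := hb h
    refine ⟨c, v - u * C (a 0)⁻¹ * C (a 1), u * C (a 0)⁻¹, ?_⟩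
    linear_combination (-u * F.mulSeries ℓ 0) * hC h0

theorem mulSeries_map {R S : Type*} [CommRing R] [CommRing S] {n : ℕ} (φ : R →+* S)
    (F : FormalGroupLaw R n) : ∀ (m : ℕ) (i : Fin n),
      (F.map φ).mulSeries m i = MvPowerSeries.map φ (F.mulSeries m i)
  | 0, i => by simp [mulSeries]
  | 1, i => by simp [mulSeries]
  | m + 2, i => by
    rw [mulSeries, mulSeries,
      map_subst (hasSubst_elim (by simp) (F.constantCoeff_mulSeries (m + 1)))]
    change subst _ (MvPowerSeries.map φ (F.series i)) = _
    congr 1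
    funext s
    rcases s with j | j
    · simp
    · simp [mulSeries_map φ F (m + 1) j]

theorem powCoeffMatrix_map {R S : Type*} [CommRing R] [CommRing S] {n : ℕ} (φ : R →+* S)
    (F : FormalGroupLaw R n) (ℓ q : ℕ) :
    (F.map φ).powCoeffMatrix ℓ q = (F.powCoeffMatrix ℓ q).map φ := by
  ext i j
  simp [powCoeffMatrix, mulSeries_map]

/-- `[m]ᵢ(Z) ≡ m Zᵢ` modulo terms of degree two. -/
theorem coeff_mulSeries_of_degree_lt_two {R : Type*} [CommRing R] {n : ℕ}
    (F : FormalGroupLaw R n) : ∀ (m : ℕ) (i : Fin n) (d : Fin n →₀ ℕ), d.degree < 2 →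
      coeff d (F.mulSeries m i) = coeff d ((m : MvPowerSeries (Fin n) R) * X i)
  | 0, i, d, _ => by simp [mulSeries]
  | 1, i, d, _ => by simp [mulSeries]
  | m + 2, i, d, hd => by
    have hs := hasSubst_elim (a := X) (by simp) (F.constantCoeff_mulSeries (m + 1))
    -- Substituting series without constant term does not lower the order, so the non-linear part of
    -- F contributes nothing in degrees below 2.
    have hord : ((2 : ℕ) : ℕ∞) ≤ (F.series i - (X (Sum.inl i) + X (Sum.inr i))).order :=
      nat_le_order fun e he => by rw [map_sub, F.linear_part i e he, sub_self]
    have hone : (1 : ℕ∞) ≤ ⨅ s, (Sum.elim X (F.mulSeries (m + 1)) s).order := by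
      refine le_iInf fun s => ?_
      rw [one_le_order_iff_constCoeff_eq_zero]
      rcases s with j | j
      · simp
      · exact F.constantCoeff_mulSeries (m + 1) j
    have h2 := (mul_le_mul' hone hord).trans (le_order_subst hs _)
    have h0 := coeff_of_lt_order (d := d) (lt_of_lt_of_le (by rw [one_mul]; exact_mod_cast hd) h2)
    rw [subst_sub hs, subst_add hs, subst_X hs, subst_X hs, map_sub, sub_eq_zero] at h0
    rw [mulSeries, h0, map_add, Sum.elim_inl, Sum.elim_inr,
      coeff_mulSeries_of_degree_lt_two F (m + 1) i d hd, ← map_add]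
    congr 1
    push_cast
    ring

end FormalGroupLaw

/-! ### Evaluation of power series and its compatibility with substitution. -/

namespace MvPowerSeries

open scoped MvPowerSeries.WithPiTopology

section

variable {σ τ R S : Type*} [CommRing R] [CommRing S] [UniformSpace S] [Algebra R S]

/-- The value of a power series at a point of a complete linearly topologized algebra, the topology
of the ring of coefficients being irrelevant. -/
def evalPoint (b : σ → S) (f : MvPowerSeries σ R) : S :=
  letI : UniformSpace R := ⊥
  eval₂ (algebraMap R S) b f

theorem evalPoint_X (b : σ → S) (s : σ) : evalPoint b (X s : MvPowerSeries σ R) = b s := by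
  let : UniformSpace R := ⊥
  exact eval₂_X _ _ s

variable [IsUniformAddGroup S] [IsTopologicalRing S] [IsLinearTopology S S] [CompleteSpace S]
  [T2Space S]

theorem hasSum_evalPoint {b : σ → S} (hb : HasEval b) (f : MvPowerSeries σ R) :
    HasSum (fun d : σ →₀ ℕ => algebraMap R S (coeff d f) * d.prod fun s e => b s ^ e)
      (evalPoint b f) := by
  let : UniformSpace R := ⊥
  exact hasSum_eval₂ continuous_of_discreteTopology hb f

theorem evalPoint_zero {b : σ → S} (hb : HasEval b) :
    evalPoint b (0 : MvPowerSeries σ R) = 0 := by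
  refine (hasSum_evalPoint hb _).unique ?_
  simp

theorem HasSubst.hasEval_evalPoint {a : σ → MvPowerSeries τ R} (ha : HasSubst a) {b : τ → S}
    (hb : HasEval b) : HasEval fun s => evalPoint b (a s) := by
  let : UniformSpace R := ⊥
  have hc : Continuous (algebraMap R S) := continuous_of_discreteTopology
  have h := ha.hasEval.map (φ := eval₂Hom hc hb)
    (by rw [coe_eval₂Hom]; exact continuous_eval₂ hc hb)
  rw [coe_eval₂Hom] at h
  exact h

theorem evalPoint_subst {a : σ → MvPowerSeries τ R} (ha : HasSubst a) {b : τ → S}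
    (hb : HasEval b) (f : MvPowerSeries σ R) :
    evalPoint b (subst a f) = evalPoint (fun s => evalPoint b (a s)) f := by
  let : UniformSpace R := ⊥
  have : ContinuousSMul R S := DiscreteTopology.instContinuousSMul R S
  exact eval₂_subst ha hb f

end

end MvPowerSeries

/-- The elements of norm at most one of an intermediate field. -/
def unitBallSubring {K L : Type*} [Field K] [NormedField L] [IsUltrametricDist L] [Algebra K L]
    (E : IntermediateField K L) : Subring L where
  carrier := {x | x ∈ E ∧ ‖x‖ ≤ 1}
  mul_mem' ha hb := ⟨mul_mem ha.1 hb.1, (norm_mul _ _).trans_le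
    (mul_le_one₀ ha.2 (norm_nonneg _) hb.2)⟩
  one_mem' := ⟨one_mem _, norm_one.le⟩
  add_mem' ha hb := ⟨add_mem ha.1 hb.1,
    (IsUltrametricDist.norm_add_le_max _ _).trans (max_le ha.2 hb.2)⟩
  zero_mem' := ⟨zero_mem _, by simp⟩
  neg_mem' ha := ⟨neg_mem ha.1, by simpa using ha.2⟩

section

variable {K L : Type*} [NontriviallyNormedField K] [NormedField L]
  [IsUltrametricDist L] [NormedAlgebra K L] (E : IntermediateField K L)

instance : IsUltrametricDist (unitBallSubring E) :=
  ⟨fun x y z => IsUltrametricDist.dist_triangle_max (x : L) y z⟩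

/-- Open balls around 0 are ideals, since the scalars have norm at most one. -/
instance : IsLinearTopology (unitBallSubring E) (unitBallSubring E) := by
  let I (ε : {ε : ℝ // 0 < ε}) : Ideal (unitBallSubring E) :=
    { carrier := {x | ‖x‖ < ε}
      add_mem' := fun ha hb =>
        (IsUltrametricDist.norm_add_le_max _ _).trans_lt (max_lt ha hb)
      zero_mem' := by simpa using ε.2
      smul_mem' := fun c x hx => (norm_mul_le c x).trans_lt
        ((mul_le_of_le_one_left (norm_nonneg x) c.2.2).trans_lt hx) }
  refine IsLinearTopology.mk_of_hasBasis (p := fun _ => True) (s := I) _ ?_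
  refine Metric.nhds_basis_ball.to_hasBasis (fun ε hε => ⟨⟨ε, hε⟩, trivial, ?_⟩)
    fun ε _ => ⟨ε, ε.2, ?_⟩
  · intro x hx
    exact mem_ball_zero_iff.2 hx
  · intro x hx
    exact mem_ball_zero_iff.1 hx

instance [CompleteSpace K] [FiniteDimensional K E] : CompleteSpace (unitBallSubring E) := by
  have h1 : IsComplete (E : Set L) := by
    have : FiniteDimensional K E.toSubalgebra.toSubmodule := ‹FiniteDimensional K E›
    exact E.toSubalgebra.toSubmodule.complete_of_finiteDimensional
  refine completeSpace_coe_iff_isComplete.2 fun f hf hfs => ?_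
  obtain ⟨x, hx, hfx⟩ := h1 f hf (hfs.trans (Filter.principal_mono.2 fun y hy => hy.1))
  have := hf.1
  exact ⟨x, ⟨hx, le_of_tendsto ((continuous_norm.tendsto x).mono_left hfx)
    (Filter.mem_of_superset (Filter.le_principal_iff.1 hfs) fun y hy => hy.2)⟩, hfx⟩

theorem hasEval_of_norm_lt_one {σ : Type*} [Finite σ] {b : σ → unitBallSubring E}
    (hb : ∀ s, ‖b s‖ < 1) : MvPowerSeries.HasEval b where
  hpow s := tendsto_pow_atTop_nhds_zero_of_norm_lt_one (hb s)
  tendsto_zero := by simp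

end

section

variable {ℓ : ℕ} [Fact ℓ.Prime]

/-- The inclusion of `ℤ_ℓ` in the ring of integers of an extension of `ℚ_ℓ`. -/
def padicIntToUnitBall (E : IntermediateField ℚ_[ℓ] (PadicAlgCl ℓ)) :
    ℤ_[ℓ] →+* unitBallSubring E :=
  ((algebraMap ℚ_[ℓ] (PadicAlgCl ℓ)).comp (algebraMap ℤ_[ℓ] ℚ_[ℓ])).codRestrict _ fun x =>
    ⟨E.algebraMap_mem _, by
      simpa using (PadicAlgCl.norm_extends ℓ (x : ℚ_[ℓ])).trans_le x.2⟩

instance (E : IntermediateField ℚ_[ℓ] (PadicAlgCl ℓ)) : Algebra ℤ_[ℓ] (unitBallSubring E) :=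
  (padicIntToUnitBall E).toAlgebra

open MvPowerSeries

/-- The algebraic closure is not complete: convergence is obtained in the complete unit ball of a
finite extension and carried over by the continuous inclusion. -/
theorem hasSum_algClEval {σ : Type*} {E : IntermediateField ℚ_[ℓ] (PadicAlgCl ℓ)}
    [FiniteDimensional ℚ_[ℓ] E] {b : σ → unitBallSubring E} (hb : HasEval b)
    (f : MvPowerSeries σ ℤ_[ℓ]) :
    HasSum (fun d : σ →₀ ℕ =>
      algebraMap ℚ_[ℓ] (PadicAlgCl ℓ) ((coeff d f : ℤ_[ℓ]) : ℚ_[ℓ]) *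
        d.prod fun s e => (b s : PadicAlgCl ℓ) ^ e) (evalPoint b f : unitBallSubring E) := by
  convert (hasSum_evalPoint hb f).map (unitBallSubring E).subtype continuous_subtype_val using 2
  · simp only [Finsupp.prod, Function.comp_apply, map_mul, map_prod, map_pow]
    rfl
  · rfl

theorem algClEval_coe {σ : Type*} [Finite σ] {E : IntermediateField ℚ_[ℓ] (PadicAlgCl ℓ)}
    [FiniteDimensional ℚ_[ℓ] E] {b : σ → unitBallSubring E} (hb : HasEval b)
    (f : MvPowerSeries σ ℤ_[ℓ]) :
    algClEval f (fun s => (b s : PadicAlgCl ℓ)) = evalPoint b f :=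
  (hasSum_algClEval hb f).tsum_eq

namespace FormalGroupLaw

theorem nsmulPoint_coe {n : ℕ} (F : FormalGroupLaw ℤ_[ℓ] n)
    {E : IntermediateField ℚ_[ℓ] (PadicAlgCl ℓ)} [FiniteDimensional ℚ_[ℓ] E]
    {b : Fin n → unitBallSubring E} (hb : HasEval b) : ∀ (m : ℕ) (i : Fin n),
      F.nsmulPoint m (fun s => (b s : PadicAlgCl ℓ)) i = evalPoint b (F.mulSeries m i)
  | 0, i => by simp [nsmulPoint, mulSeries, evalPoint_zero hb]
  | 1, i => by simp [nsmulPoint, mulSeries, evalPoint_X]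
  | m + 2, i => by
    have hs := hasSubst_elim (a := X) (by simp) (F.constantCoeff_mulSeries (m + 1))
    rw [mulSeries, evalPoint_subst hs hb, ← algClEval_coe (hs.hasEval_evalPoint hb), nsmulPoint,
      addPoint]
    congr 1
    funext s
    rcases s with j | j
    · simp [evalPoint_X]
    · simp [nsmulPoint_coe F hb (m + 1) j]

/-- The power series `[m]ᵢ` converge at the points of positive valuation, and compute their
multiples for the addition law of `F`. -/
theorem hasSum_nsmulPoint {n : ℕ} (F : FormalGroupLaw ℤ_[ℓ] n) {x : Fin n → PadicAlgCl ℓ}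
    (hx : ∀ i, ‖x i‖ < 1) (m : ℕ) (i : Fin n) :
    HasSum (fun d : Fin n →₀ ℕ =>
      algebraMap ℚ_[ℓ] (PadicAlgCl ℓ) ((coeff d (F.mulSeries m i) : ℤ_[ℓ]) : ℚ_[ℓ]) *
        d.prod fun s e => x s ^ e) (F.nsmulPoint m x i) := by
  -- The finitely many algebraic coordinates generate a finite, hence complete, extension of ℚ_ℓ.
  let E := IntermediateField.adjoin ℚ_[ℓ] (Set.range x)
  have : FiniteDimensional ℚ_[ℓ] E :=
    IntermediateField.finiteDimensional_adjoin fun y _ =>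
      (Algebra.IsAlgebraic.isAlgebraic y).isIntegral
  let b (i : Fin n) : unitBallSubring E :=
    ⟨x i, IntermediateField.subset_adjoin _ _ ⟨i, rfl⟩, (hx i).le⟩
  have hb : HasEval b := hasEval_of_norm_lt_one E hx
  have h := hasSum_algClEval hb (F.mulSeries m i)
  rw [← nsmulPoint_coe F hb] at h
  exact h

end FormalGroupLaw

end

/-! ### Ultrametric estimates and the norm of a torsion point. -/

theorem HasSum.norm_sub_sum_le {ι L : Type*} [SeminormedAddCommGroup L] [IsUltrametricDist L]
    {f : ι → L} {a : L} (h : HasSum f a) {T : Finset ι} {B : ℝ} (hB : 0 ≤ B)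
    (hf : ∀ i ∉ T, ‖f i‖ ≤ B) : ‖a - ∑ i ∈ T, f i‖ ≤ B := by
  classical
  have h' : Filter.Tendsto (fun S : Finset ι => ‖∑ i ∈ S, f i - ∑ i ∈ T, f i‖) Filter.atTop
      (nhds ‖a - ∑ i ∈ T, f i‖) := (Filter.Tendsto.sub_const h _).norm
  refine le_of_tendsto h' (Filter.eventually_atTop.2 ⟨T, fun S hS => ?_⟩)
  rw [← Finset.sum_sdiff hS, add_sub_cancel_right]
  exact IsUltrametricDist.norm_sum_le_of_forall_le_of_nonneg hB fun i hi =>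
    hf i (Finset.mem_sdiff.1 hi).2

theorem norm_sub_le_max_of_isUltrametricDist {L : Type*} [SeminormedAddCommGroup L]
    [IsUltrametricDist L] (x y : L) : ‖x - y‖ ≤ max ‖x‖ ‖y‖ := by
  simpa [sub_eq_add_neg] using IsUltrametricDist.norm_add_le_max x (-y)

namespace PadicInt

variable {ℓ : ℕ} [Fact ℓ.Prime]

theorem norm_le_inv_of_toZMod_eq_zero {c : ℤ_[ℓ]} (hc : toZMod c = 0) : ‖c‖ ≤ (ℓ : ℝ)⁻¹ := by
  rw [← RingHom.mem_ker, ker_toZMod, maximalIdeal_eq_span_p, Ideal.mem_span_singleton'] at hc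
  obtain ⟨u, rfl⟩ := hc
  rw [norm_mul, norm_p]
  exact mul_le_of_le_one_left (by positivity) u.2

theorem isUnit_of_toZMod_ne_zero {c : ℤ_[ℓ]} (hc : toZMod c ≠ 0) : IsUnit c := by
  rw [ne_eq, ← RingHom.mem_ker, ker_toZMod, IsLocalRing.mem_maximalIdeal, mem_nonunits_iff,
    not_not] at hc
  exact hc

end PadicInt

section

variable {ℓ : ℕ} [Fact ℓ.Prime]

/-- The inclusion of `ℤ_ℓ` in the algebraic closure of `ℚ_ℓ`. -/
def padicIntToAlgCl (ℓ : ℕ) [Fact ℓ.Prime] : ℤ_[ℓ] →+* PadicAlgCl ℓ :=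
  (algebraMap ℚ_[ℓ] (PadicAlgCl ℓ)).comp (algebraMap ℤ_[ℓ] ℚ_[ℓ])

theorem norm_padicIntToAlgCl (c : ℤ_[ℓ]) : ‖padicIntToAlgCl ℓ c‖ = ‖c‖ :=
  PadicAlgCl.norm_extends ℓ (c : ℚ_[ℓ])

theorem norm_padicIntToAlgCl_mul_le (c : ℤ_[ℓ]) (x : PadicAlgCl ℓ) :
    ‖padicIntToAlgCl ℓ c * x‖ ≤ ‖x‖ := by
  rw [norm_mul, norm_padicIntToAlgCl]
  exact mul_le_of_le_one_left (norm_nonneg x) c.2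

theorem norm_sum_padicInt_mul_le {n : ℕ} {B : ℝ} (hB : 0 ≤ B) (c : Fin n → ℤ_[ℓ])
    {v : Fin n → PadicAlgCl ℓ} (hv : ∀ j, ‖v j‖ ≤ B) :
    ‖∑ j, padicIntToAlgCl ℓ (c j) * v j‖ ≤ B :=
  IsUltrametricDist.norm_sum_le_of_forall_le_of_nonneg hB fun j _ =>
    (norm_padicIntToAlgCl_mul_le _ _).trans (hv j)

/-- A matrix in `GLₙ(ℤ_ℓ)` preserves the maximum of the norms of the coordinates. -/
theorem norm_le_of_norm_mulVec_le {n : ℕ} {M : Matrix (Fin n) (Fin n) ℤ_[ℓ]} (hM : IsUnit M.det)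
    {v : Fin n → PadicAlgCl ℓ} {B : ℝ} (hB : 0 ≤ B)
    (h : ∀ i, ‖∑ j, padicIntToAlgCl ℓ (M i j) * v j‖ ≤ B) (j : Fin n) : ‖v j‖ ≤ B := by
  -- The inverse matrix also has entries in ℤ_ℓ, so applying it does not raise the bound.
  have hv : (M⁻¹.map (padicIntToAlgCl ℓ)).mulVec ((M.map (padicIntToAlgCl ℓ)).mulVec v) = v := by
    rw [Matrix.mulVec_mulVec, ← Matrix.map_mul, Matrix.nonsing_inv_mul _ hM,
      Matrix.map_one _ (map_zero _) (map_one _), Matrix.one_mulVec]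
  rw [← congrFun hv j]
  exact norm_sum_padicInt_mul_le hB _ h

theorem norm_finsuppProd_le {n : ℕ} {x : Fin n → PadicAlgCl ℓ} {r : ℝ} (hx : ∀ i, ‖x i‖ ≤ r)
    (d : Fin n →₀ ℕ) : ‖d.prod fun s e => x s ^ e‖ ≤ r ^ d.degree := by
  rw [Finsupp.prod_fintype _ _ (by simp), norm_prod, Finsupp.degree_eq_sum,
    ← Finset.prod_pow_eq_pow_sum]
  refine Finset.prod_le_prod (fun _ _ => norm_nonneg _) fun i _ => ?_
  rw [norm_pow]
  exact pow_le_pow_left₀ (norm_nonneg _) (hx i) _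

namespace FormalGroupLaw

open MvPowerSeries

theorem coeff_single_one_mulSeries {R : Type*} [CommRing R] {n : ℕ} (F : FormalGroupLaw R n)
    (m : ℕ) (i j : Fin n) :
    coeff (Finsupp.single j 1) (F.mulSeries m i) = if j = i then (m : R) else 0 := by
  classical
  rw [F.coeff_mulSeries_of_degree_lt_two m i _ (by simp), ← map_natCast (C (σ := Fin n) (R := R)),
    coeff_C_mul, coeff_X]
  simp [Finsupp.single_left_inj]

/-- The linear part of `[ℓ]` and its part of degree `ℓ ^ r` dominate all the other terms. -/
theorem norm_nsmulPoint_sub_le {n r : ℕ} (F : FormalGroupLaw ℤ_[ℓ] n) (hr : 1 ≤ r)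
    (hF : F.reduction.HasFrobeniusExponent ℓ r) {x : Fin n → PadicAlgCl ℓ} {ρ : ℝ} (hρ0 : 0 ≤ ρ)
    (hρ1 : ρ < 1) (hx : ∀ i, ‖x i‖ ≤ ρ) (i : Fin n) :
    ‖F.nsmulPoint ℓ x i - (ℓ * x i +
      ∑ j, padicIntToAlgCl ℓ (F.powCoeffMatrix ℓ (ℓ ^ r) i j) * x j ^ ℓ ^ r)‖ ≤
      max ((ℓ : ℝ)⁻¹ * ρ ^ 2) (ρ ^ (ℓ ^ r + 1)) := by
  classical
  have hq : 1 < ℓ ^ r := Nat.one_lt_pow (by omega) (Fact.out : ℓ.Prime).one_lt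
  have hinj {q : ℕ} (hq : q ≠ 0) : Function.Injective fun j : Fin n => Finsupp.single j q :=
    Finsupp.single_left_injective hq
  let T₁ : Finset (Fin n →₀ ℕ) := Finset.univ.image fun j => Finsupp.single j 1
  let T₂ : Finset (Fin n →₀ ℕ) := Finset.univ.image fun j => Finsupp.single j (ℓ ^ r)
  have hdisj : Disjoint T₁ T₂ := by
    rw [Finset.disjoint_left]
    intro d h1 h2
    obtain ⟨j, -, rfl⟩ := Finset.mem_image.1 h1
    obtain ⟨k, -, hk⟩ := Finset.mem_image.1 h2
    have := congrArg Finsupp.degree hk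
    simp only [Finsupp.degree_single] at this
    omega
  have hsum := (F.hasSum_nsmulPoint (fun i => (hx i).trans_lt hρ1) ℓ i).norm_sub_sum_le
    (T := T₁ ∪ T₂) (B := max ((ℓ : ℝ)⁻¹ * ρ ^ 2) (ρ ^ (ℓ ^ r + 1)))
    (le_max_of_le_right (by positivity)) ?_
  · rw [Finset.sum_union hdisj, Finset.sum_image fun a _ b _ h => hinj one_ne_zero h,
      Finset.sum_image fun a _ b _ h => hinj (by omega) h] at hsum
    have hlin : ∑ j, padicIntToAlgCl ℓ (coeff (Finsupp.single j 1) (F.mulSeries ℓ i)) *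
        (Finsupp.single j 1).prod (fun s e => x s ^ e) = ℓ * x i := by
      simp only [coeff_single_one_mulSeries]
      rw [Finset.sum_eq_single i (by intro j _ hj; simp [hj]) (by simp)]
      simp
    have hpow : ∑ j, padicIntToAlgCl ℓ (coeff (Finsupp.single j (ℓ ^ r)) (F.mulSeries ℓ i)) *
        (Finsupp.single j (ℓ ^ r)).prod (fun s e => x s ^ e) =
        ∑ j, padicIntToAlgCl ℓ (F.powCoeffMatrix ℓ (ℓ ^ r) i j) * x j ^ ℓ ^ r :=
      Finset.sum_congr rfl fun j _ => by
        rw [Finsupp.prod_single_index (h := fun s e => x s ^ e) (pow_zero _), powCoeffMatrix_apply]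
    rw [← hlin, ← hpow]
    exact hsum
  · intro d hd
    change ‖padicIntToAlgCl ℓ _ * _‖ ≤ _
    -- A coefficient divisible by ℓ gains ℓ⁻¹, and outside `T₁` only degrees at least 2 matter. Any
    -- other coefficient survives in the reduction, which outside `T₂` forces degree at least ℓ^r +
    -- 1.
    by_cases hc : PadicInt.toZMod (coeff d (F.mulSeries ℓ i)) = 0
    · rcases lt_or_ge d.degree 2 with hdeg | hdeg
      · rw [F.coeff_mulSeries_of_degree_lt_two ℓ i d hdeg,
          ← map_natCast (C (σ := Fin n) (R := ℤ_[ℓ])), coeff_C_mul, coeff_X, if_neg, mul_zero,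
          map_zero, zero_mul, norm_zero]
        · exact le_max_of_le_right (by positivity)
        · rintro rfl
          exact hd (Finset.mem_union_left _ (Finset.mem_image_of_mem _ (Finset.mem_univ i)))
      · refine le_max_of_le_left ?_
        rw [norm_mul, norm_padicIntToAlgCl]
        exact mul_le_mul (PadicInt.norm_le_inv_of_toZMod_eq_zero hc)
          ((norm_finsuppProd_le hx d).trans (pow_le_pow_of_le_one hρ0 hρ1.le hdeg))
          (norm_nonneg _) (by positivity)
    · have hc' : coeff d (F.reduction.mulSeries ℓ i) ≠ 0 := by
        rwa [reduction, mulSeries_map, coeff_map]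
      have hdeg : ℓ ^ r + 1 ≤ d.degree := by
        refine lt_of_le_of_ne (hF.le_degree hc') fun h => ?_
        obtain ⟨j, rfl⟩ := hF.eq_single hc' h.symm
        exact hd (Finset.mem_union_right _ (Finset.mem_image_of_mem _ (Finset.mem_univ j)))
      exact le_max_of_le_right ((norm_padicIntToAlgCl_mul_le _ _).trans
        ((norm_finsuppProd_le hx d).trans (pow_le_pow_of_le_one hρ0 hρ1.le hdeg)))

/-- The norm of a non-zero `ℓ`-torsion point, if the part of degree `ℓ ^ r` of `[ℓ]` is
invertible. -/
theorem inv_mul_eq_pow_of_nsmulPoint_eq_zero {n r : ℕ} (F : FormalGroupLaw ℤ_[ℓ] n) (hr : 1 ≤ r)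
    (hF : F.reduction.HasFrobeniusExponent ℓ r)
    (hdet : IsUnit (F.powCoeffMatrix ℓ (ℓ ^ r)).det) {x : Fin n → PadicAlgCl ℓ} {i₀ : Fin n}
    (h0 : 0 < ‖x i₀‖) (h1 : ‖x i₀‖ < 1) (hx : ∀ i, ‖x i‖ ≤ ‖x i₀‖)
    (htors : F.nsmulPoint ℓ x = 0) : (ℓ : ℝ)⁻¹ * ‖x i₀‖ = ‖x i₀‖ ^ ℓ ^ r := by
  set ρ := ‖x i₀‖ with hρ
  have hℓ : (0 : ℝ) < (ℓ : ℝ)⁻¹ := inv_pos.2 (by exact_mod_cast (Fact.out : ℓ.Prime).pos)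
  have hnorm (y : PadicAlgCl ℓ) : ‖(ℓ : PadicAlgCl ℓ) * y‖ = (ℓ : ℝ)⁻¹ * ‖y‖ := by
    rw [← map_natCast (padicIntToAlgCl ℓ), norm_mul, norm_padicIntToAlgCl, PadicInt.norm_p]
  have hb (i : Fin n) := F.norm_nsmulPoint_sub_le hr hF h0.le h1 hx i
  simp only [htors, Pi.zero_apply, zero_sub, norm_neg] at hb
  have hB1 : (ℓ : ℝ)⁻¹ * ρ ^ 2 < (ℓ : ℝ)⁻¹ * ρ := by
    refine mul_lt_mul_of_pos_left ?_ hℓ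
    nlinarith
  have hB2 : ρ ^ (ℓ ^ r + 1) < ρ ^ ℓ ^ r := by
    rw [pow_succ]
    exact mul_lt_of_lt_one_right (by positivity) h1
  have hxq (j : Fin n) : ‖x j ^ ℓ ^ r‖ ≤ ρ ^ ℓ ^ r := by
    rw [norm_pow]
    exact pow_le_pow_left₀ (norm_nonneg _) (hx j) _
  rcases lt_trichotomy ((ℓ : ℝ)⁻¹ * ρ) (ρ ^ ℓ ^ r) with h | h | h
  -- If ρ^q dominates (q = ℓ^r), every coordinate of A x^q has norm below ρ^q, contradicting the
  -- invertibility of A.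
  · exfalso
    let B := max (max ((ℓ : ℝ)⁻¹ * ρ ^ 2) (ρ ^ (ℓ ^ r + 1))) ((ℓ : ℝ)⁻¹ * ρ)
    have hlt : B < ρ ^ ℓ ^ r := max_lt (max_lt (hB1.trans h) hB2) h
    refine hlt.not_ge ?_
    rw [hρ, ← norm_pow]
    refine norm_le_of_norm_mulVec_le (v := fun j => x j ^ ℓ ^ r) hdet
      (le_max_of_le_right (by positivity)) (fun i => ?_) i₀
    rw [← add_sub_cancel_left ((ℓ : PadicAlgCl ℓ) * x i)
      (∑ j, padicIntToAlgCl ℓ (F.powCoeffMatrix ℓ (ℓ ^ r) i j) * x j ^ ℓ ^ r)]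
    refine (norm_sub_le_max_of_isUltrametricDist _ _).trans (max_le_max (hb i) ?_)
    rw [hnorm]
    exact mul_le_mul_of_nonneg_left (hx i) hℓ.le
  · exact h
  -- If ρ/ℓ dominates, the term ℓ x_{i₀}, of norm exactly ρ/ℓ, cannot be cancelled in the coordinate
  -- i₀.
  · exfalso
    have hlt : max (max ((ℓ : ℝ)⁻¹ * ρ ^ 2) (ρ ^ (ℓ ^ r + 1))) (ρ ^ ℓ ^ r) < (ℓ : ℝ)⁻¹ * ρ :=
      max_lt (max_lt hB1 (hB2.trans h)) h
    refine hlt.not_ge ?_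
    rw [hρ, ← hnorm, ← add_sub_cancel_right ((ℓ : PadicAlgCl ℓ) * x i₀)
      (∑ j, padicIntToAlgCl ℓ (F.powCoeffMatrix ℓ (ℓ ^ r) i₀ j) * x j ^ ℓ ^ r)]
    exact (norm_sub_le_max_of_isUltrametricDist _ _).trans
      (max_le_max (hb i₀) (norm_sum_padicInt_mul_le (by positivity) _ hxq))

end FormalGroupLaw

/-! ### From norms to valuations, and the conclusion. -/

theorem norm_lt_one_of_algClVal_pos {x : PadicAlgCl ℓ} (hx : 0 < algClVal x) : ‖x‖ < 1 := by
  by_cases h : x = 0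
  · simp [h]
  · rw [algClVal, if_neg h, ← WithTop.coe_zero, WithTop.coe_lt_coe, neg_pos] at hx
    by_contra hle
    exact hx.not_ge (Real.logb_nonneg (by exact_mod_cast (Fact.out : ℓ.Prime).one_lt)
      (not_lt.1 hle))

theorem algClVal_antitone {x y : PadicAlgCl ℓ} (h : ‖y‖ ≤ ‖x‖) : algClVal x ≤ algClVal y := by
  by_cases hy : y = 0
  · simp [algClVal, hy]
  · have hx : x ≠ 0 := by
      rintro rfl
      exact hy (by simpa using h)
    rw [algClVal, algClVal, if_neg hx, if_neg hy, WithTop.coe_le_coe, neg_le_neg_iff]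
    exact Real.logb_le_logb_of_le (by exact_mod_cast (Fact.out : ℓ.Prime).one_lt)
      (norm_pos_iff.2 hy) h

/-- In base-ℓ logarithms the hypothesis reads 1 + v = qv. -/
theorem algClVal_eq_of_inv_mul_eq_pow {x : PadicAlgCl ℓ} (hx : x ≠ 0) {q : ℕ} (hq : 1 < q)
    (h : (ℓ : ℝ)⁻¹ * ‖x‖ = ‖x‖ ^ q) : algClVal x = ((1 / ((q : ℝ) - 1) : ℝ) : WithTop ℝ) := by
  have hℓ : (1 : ℝ) < ℓ := by exact_mod_cast (Fact.out : ℓ.Prime).one_lt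
  have hq' : (1 : ℝ) < q := by exact_mod_cast hq
  have hlog := congrArg (Real.logb ℓ) h
  rw [Real.logb_mul (by positivity) (norm_ne_zero_iff.2 hx), Real.logb_inv,
    Real.logb_self_eq_one hℓ, Real.logb_pow] at hlog
  rw [algClVal, if_neg hx, WithTop.coe_inj, eq_div_iff (by linarith)]
  linarith

end

end

theorem mainTheorem5 (ℓ : ℕ) [Fact ℓ.Prime] (hℓ : 2 < ℓ)
    (F : FormalGroupLaw ℤ_[ℓ] 2) (hsymm : F.IsSymmetric)
    (hheight : F.reduction.HasHeight ℓ 4)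
    (hexponent : F.reduction.HasFrobeniusExponent ℓ 2)
    (x₀ y₀ : PadicAlgCl ℓ) (hV : ![x₀, y₀] ∈ F.torsionPoints) (hne : ![x₀, y₀] ≠ 0) :
    min (algClVal x₀) (algClVal y₀) = ((1 / ((ℓ : ℝ) ^ 2 - 1) : ℝ) : WithTop ℝ) := by
  obtain ⟨hpos, htors⟩ := hV
  have hdet : IsUnit (F.powCoeffMatrix ℓ (ℓ ^ 2)).det := by
    refine PadicInt.isUnit_of_toZMod_ne_zero ?_
    have h := F.reduction.det_powCoeffMatrix_ne_zero (by omega) hheight hexponent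
    rwa [FormalGroupLaw.reduction, FormalGroupLaw.powCoeffMatrix_map, ← RingHom.mapMatrix_apply,
      ← RingHom.map_det] at h
  -- The minimum of the valuations is attained at a coordinate of largest norm, which is non-zero
  -- because the point is.
  have key (i₀ : Fin 2) (hx : ∀ i, ‖![x₀, y₀] i‖ ≤ ‖![x₀, y₀] i₀‖) :
      algClVal (![x₀, y₀] i₀) = ((1 / ((ℓ : ℝ) ^ 2 - 1) : ℝ) : WithTop ℝ) := by
    have h0 : ![x₀, y₀] i₀ ≠ 0 := by
      intro h
      refine hne (funext fun i => norm_le_zero_iff.1 ?_)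
      simpa [h] using hx i
    have h := F.inv_mul_eq_pow_of_nsmulPoint_eq_zero (by norm_num) hexponent hdet
      (norm_pos_iff.2 h0) (norm_lt_one_of_algClVal_pos (hpos i₀)) hx htors
    have := algClVal_eq_of_inv_mul_eq_pow h0 (Nat.one_lt_pow (by norm_num) (by omega)) h
    rwa [Nat.cast_pow] at this
  rcases le_total ‖y₀‖ ‖x₀‖ with h | h
  · rw [min_eq_left (algClVal_antitone h)]
    exact key 0 (by intro i; fin_cases i <;> simp [h])
  · rw [min_eq_right (algClVal_antitone h)]
    exact key 1 (by intro i; fin_cases i <;> simp [h])
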